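/- For $z\in\mathbb{C}$ put $\|z\|=\max\{|\mathrm{Re}\,z|,|\mathrm{Im}\,z|\}$ and let $[z]=\lfloor \mathrm{Re}(z)+\tfrac12\rfloor+i\lfloor \mathrm{Im}(z)+\tfrac12\rfloor$ be the nearest Gaussian integer. Let $\mathfrak{F}=\{z\in\mathbb{C}:[z]=0\}$ and let $T:\mathfrak{F}\to\mathfrak{F}$ be the complex Gauss map, $T(0)=0$ and $T(z)=z^{-1}-[z^{-1}]$ for $z\neq 0$. The Hurwitz partial quotients of $z\in\mathfrak{F}$ are $a_j(z)=[(T^{j-1}z)^{-1}]$, defined for those $j\ge 1$ with $T^{j-1}z\neq 0$. Let $\mathscr{D}=\{a\in\mathbb{Z}[i]:|a|\ge\sqrt2\}$. For a word $\mathbf{a}=(a_1,\dots,a_n)\in\mathscr{D}^n$, its cylinder is $$\mathcal{C}_n(\mathbf{a})=\{z\in\mathfrak{F}: a_1(z)=a_1,\dots,a_n(z)=a_n\},$$ and $\overline{\mathcal{C}}_n(\mathbf{a})$ denotes the closure of $\mathcal{C}_n(\mathbf{a})$ in $\mathbb{C}$. The word $\mathbf{a}$ is called regular if $\mathcal{C}_n(\mathbf{a})$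 has non-empty interior, and irregular if $\mathcal{C}_n(\mathbf{a})$ is non-empty but has empty interior. Let $\mathrm{Di}_8$ be the group (under composition) of isometries of $\mathbb{C}$ generated by $z\mapsto iz$ and $z\mapsto\overline{z}$; it is a dihedral group of order $8$. Theorem. For every integer $n\ge2$, every irregular word $\mathbf{a}=(a_1,\dots,a_n)\in\mathscr{D}^n$, and every $f\in\mathrm{Di}_8$, there is a regular word $\mathbf{b}=(b_1,\dots,b_n)\in\mathscr{D}^n$ such that $$f[\mathcal{C}_n(\mathbf{a})]\subseteq\overline{\mathcal{C}}_n(\mathbf{b})\quad\text{and}\quad \|a_j\|=\|b_j\|\ \text{ for all } j\in\{1,\dots,n\}.$$ -/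

import Mathlib

namespace HurwitzCF

/-- The sup norm `max {|Re z|, |Im z|}` on the complex plane. -/
noncomputable def supNorm (z : ℂ) : ℝ := max |z.re| |z.im|

/-- The Gaussian integer `⌊Re z + 1/2⌋ + i ⌊Im z + 1/2⌋` nearest to `z`. -/
noncomputable def nearest (z : ℂ) : GaussianInt := ⟨⌊z.re + 1 / 2⌋, ⌊z.im + 1 / 2⌋⟩

/-- The half-open unit square of all complex numbers whose nearest Gaussian integer is `0`. -/
def fundamentalSquare : Set ℂ := {z | nearest z = 0}

/-- The complex Gauss map. It sends every complex number into the half-open unit square. -/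
noncomputable def gaussMap (z : ℂ) : ℂ :=
  if z = 0 then 0 else z⁻¹ - GaussianInt.toComplex (nearest z⁻¹)

theorem gaussMap_mem (z : ℂ) : gaussMap z ∈ fundamentalSquare := by
  unfold gaussMap fundamentalSquare
  split_ifs with h
  · simp only [Set.mem_ofPred_eq, nearest]
    ext <;> norm_num
  · simp only [Set.mem_ofPred_eq, nearest]
    ext
    · simp only [Complex.sub_re, GaussianInt.toComplex_def₂, Zsqrtd.re_zero]
      rw [sub_add_eq_add_sub, Int.floor_sub_intCast, sub_self]
    · simp only [Complex.sub_im, GaussianInt.toComplex_def₂, Zsqrtd.im_zero]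
      rw [sub_add_eq_add_sub, Int.floor_sub_intCast, sub_self]

/-- The set of admissible digits: Gaussian integers of absolute value at least `√2`. -/
def digits : Set GaussianInt := {a | √2 ≤ ‖GaussianInt.toComplex a‖}

/-- `partialQuotient j z` is the `(j+1)`-st Hurwitz partial quotient of `z`
(`j = 0, 1, 2, …`). It is meaningful only if the `j`-th iterate of the Gauss map at `z` is
not `0`; this condition is imposed wherever partial quotients are used. -/
noncomputable def partialQuotient (j : ℕ) (z : ℂ) : GaussianInt := nearest (gaussMap^[j] z)⁻¹

/-- The cylinder of level `n` based on the word `a`: all `z` in the half-open unit square whose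
first `n` partial quotients exist and are the letters of `a`. -/
def cylinder {n : ℕ} (a : Fin n → digits) : Set ℂ :=
  {z | z ∈ fundamentalSquare ∧
    ∀ j : Fin n, gaussMap^[(j : ℕ)] z ≠ 0 ∧ partialQuotient j z = a j}

/-- A word is valid if its cylinder is non-empty. -/
def IsValid {n : ℕ} (a : Fin n → digits) : Prop := (cylinder a).Nonempty

/-- A word is regular if its cylinder has non-empty interior. -/
def IsRegular {n : ℕ} (a : Fin n → digits) : Prop := (interior (cylinder a)).Nonempty

/-- A word is irregular if it is valid and its cylinder has empty interior. -/
def IsIrregular {n : ℕ} (a : Fin n → digits) : Prop :=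
  IsValid a ∧ interior (cylinder a) = ∅

/-- The rotation `z ↦ i z`, as an isometry of the complex plane. -/
noncomputable def rot : ℂ ≃ᵢ ℂ :=
  (rotation ⟨Complex.I, by simp [Submonoid.unitSphere]⟩).toIsometryEquiv

/-- The reflection `z ↦ conj z`, as an isometry of the complex plane. -/
noncomputable def mir : ℂ ≃ᵢ ℂ := Complex.conjLIE.toIsometryEquiv

theorem rot_apply (z : ℂ) : rot z = Complex.I * z := rfl

theorem mir_apply (z : ℂ) : mir z = (starRingEnd ℂ) z := rfl

/-- The group of isometries (under composition) generated by `rot` and `mir`; it is the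
symmetry group of the square, a dihedral group of order `8`. -/
noncomputable def dihedralEight : Subgroup (ℂ ≃ᵢ ℂ) := Subgroup.closure {rot, mir}

end HurwitzCF

namespace HurwitzCF

open ComplexConjugate

/-! Follow the iterates of a cylinder under the Gauss map. At each stage the points available lie in
the square minus unit discs around some of the eight neighbours of `0`; the set `S` of centres is
the state. Inversion sends the sides of the square and the discs around units to each other (as
half-planes), and discs around `±1±i` to discs of the same kind, so appending a digit `e` gives a
new state `step S e`.

Inside the closed region of `S`, a given digit is either `Admissible`, so that it occurs on an open
set, or else all points having it map to a single side of the square (`exists_digit_across`). In the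
second case the neighbouring digit across that side is admissible and has the same sup norm.
Changing to it translates the tails by a unit, and on that side this translation coincides with a
reflection of the square (`add_star_eq_act`). The tails are thus carried by another symmetry in
`Di₈`, the same one for every point of the cylinder.

The induction `exists_openPiece` therefore runs over all states and all symmetries at once. It ends
with `IsFull`: closed regions are closures of open ones, because they are star-shaped
(`isFull_step`). Pulling back by the inverse branches keeps both openness and closure. -/

/-! ### Regions cut out by unit discs -/

/-- The closed unit square with the open unit discs around the points of `S` removed. -/
def closedRegion (S : Set GaussianInt) : Set ℂ :=
  {w | |w.re| ≤ 1 / 2 ∧ |w.im| ≤ 1 / 2 ∧ ∀ c ∈ S, 1 ≤ (w.re - c.re) ^ 2 + (w.im - c.im) ^ 2}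

/-- The open unit square with the closed unit discs around the points of `S` removed. -/
def openRegion (S : Set GaussianInt) : Set ℂ :=
  {w | |w.re| < 1 / 2 ∧ |w.im| < 1 / 2 ∧ ∀ c ∈ S, 1 < (w.re - c.re) ^ 2 + (w.im - c.im) ^ 2}

/-- The centres of the discs bounding the image of the region of `S` under
`w ↦ w⁻¹ - e`. -/
def step (S : Set GaussianInt) (e : GaussianInt) : Set GaussianInt :=
  {c | (c.norm = 1 ∨ c.norm = 2) ∧
    ((c + e).norm = 1 ∨ (c + e).norm = 2 ∧ star (c + e) ∈ S)}

/-- The digit `e` may follow the region of `S` on an open set. -/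
def Admissible (S : Set GaussianInt) (e : GaussianInt) : Prop :=
  (∀ c ∈ S, c.norm = 1 → (c * e).re ≤ 0) ∧ star e ∉ S

theorem norm_eq (c : GaussianInt) : c.norm = c.re ^ 2 + c.im ^ 2 := by
  rw [Zsqrtd.norm_def]; ring

theorem norm_eq_one {c : GaussianInt} (h : c.norm = 1) :
    c = ⟨1, 0⟩ ∨ c = ⟨-1, 0⟩ ∨ c = ⟨0, 1⟩ ∨ c = ⟨0, -1⟩ := by
  obtain ⟨x, y⟩ := c
  rw [norm_eq] at h
  simp only at h
  have h1 : x ≤ 1 := by nlinarith [sq_nonneg y]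
  have h2 : -1 ≤ x := by nlinarith [sq_nonneg y]
  have h3 : y ≤ 1 := by nlinarith [sq_nonneg x]
  have h4 : -1 ≤ y := by nlinarith [sq_nonneg x]
  interval_cases x <;> interval_cases y <;> simp_all

theorem norm_eq_two {c : GaussianInt} (h : c.norm = 2) :
    c = ⟨1, 1⟩ ∨ c = ⟨1, -1⟩ ∨ c = ⟨-1, 1⟩ ∨ c = ⟨-1, -1⟩ := by
  obtain ⟨x, y⟩ := c
  rw [norm_eq] at h
  simp only at h
  have h1 : x ≤ 1 := by nlinarith [sq_nonneg y]
  have h2 : -1 ≤ x := by nlinarith [sq_nonneg y]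
  have h3 : y ≤ 1 := by nlinarith [sq_nonneg x]
  have h4 : -1 ≤ y := by nlinarith [sq_nonneg x]
  interval_cases x <;> interval_cases y <;> simp_all

theorem mem_digits_iff (e : GaussianInt) : e ∈ digits ↔ 2 ≤ e.norm := by
  have h : ‖GaussianInt.toComplex e‖ = √(e.norm : ℝ) := by
    rw [Complex.norm_def, norm_eq, Complex.normSq_apply]
    simp [sq]
  rw [digits, Set.mem_ofPred_eq, h, Real.sqrt_le_sqrt_iff (by exact_mod_cast GaussianInt.norm_nonneg e)]
  exact_mod_cast Iff.rfl

/-! ### Inversion and the transition between regions -/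

theorem re_sq_add_im_sq_pos {z : ℂ} (hz : z ≠ 0) : 0 < z.re ^ 2 + z.im ^ 2 := by
  have := Complex.normSq_pos.2 hz
  rwa [Complex.normSq_apply, ← sq, ← sq] at this

theorem re_im_inv (v : ℂ) : v⁻¹.re = v.re / (v.re ^ 2 + v.im ^ 2) ∧
    v⁻¹.im = -v.im / (v.re ^ 2 + v.im ^ 2) := by
  rw [Complex.inv_re, Complex.inv_im, Complex.normSq_apply, ← sq, ← sq]
  exact ⟨rfl, rfl⟩

/-- Inversion turns the half-plane bounded by a side of the square into the exterior of a
unit disc. -/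
theorem inv_side_sub {c : GaussianInt} (hc : c.norm = 1) {v : ℂ} (hv : v ≠ 0) :
    1 / 2 - (c.re * v⁻¹.re + c.im * v⁻¹.im) =
      ((v.re - c.re) ^ 2 + (v.im + c.im) ^ 2 - 1) / (2 * (v.re ^ 2 + v.im ^ 2)) := by
  have hc' : (c.re : ℝ) ^ 2 + (c.im : ℝ) ^ 2 = 1 := by rw [norm_eq] at hc; exact_mod_cast hc
  have := re_sq_add_im_sq_pos hv
  rw [(re_im_inv v).1, (re_im_inv v).2]
  field_simp
  linear_combination (-1 : ℝ) * hc'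

/-- Inversion turns the exterior of a unit disc around a unit into a half-plane. -/
theorem inv_unit_sub {c : GaussianInt} (hc : c.norm = 1) {v : ℂ} (hv : v ≠ 0) :
    (v⁻¹.re - c.re) ^ 2 + (v⁻¹.im - c.im) ^ 2 - 1 =
      (1 - 2 * (c.re * v.re - c.im * v.im)) / (v.re ^ 2 + v.im ^ 2) := by
  have hc' : (c.re : ℝ) ^ 2 + (c.im : ℝ) ^ 2 = 1 := by rw [norm_eq] at hc; exact_mod_cast hc
  have := re_sq_add_im_sq_pos hv
  rw [(re_im_inv v).1, (re_im_inv v).2]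
  field_simp
  linear_combination (v.re ^ 2 + v.im ^ 2) ^ 2 * hc'

/-- Inversion maps the exterior of a unit disc around `1 + i` to that around `1 - i`, and
so on. -/
theorem inv_diag_sub {c : GaussianInt} (hc : c.norm = 2) {v : ℂ} (hv : v ≠ 0) :
    (v⁻¹.re - c.re) ^ 2 + (v⁻¹.im - c.im) ^ 2 - 1 =
      ((v.re - c.re) ^ 2 + (v.im + c.im) ^ 2 - 1) / (v.re ^ 2 + v.im ^ 2) := by
  have hc' : (c.re : ℝ) ^ 2 + (c.im : ℝ) ^ 2 = 2 := by rw [norm_eq] at hc; exact_mod_cast hc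
  have := re_sq_add_im_sq_pos hv
  rw [(re_im_inv v).1, (re_im_inv v).2]
  field_simp
  linear_combination ((v.re ^ 2 + v.im ^ 2) ^ 2 - (v.re ^ 2 + v.im ^ 2)) * hc'

theorem add_ne_zero_of_digit {e : GaussianInt} (he : e ∈ digits) {w : ℂ} (h1 : |w.re| ≤ 1 / 2)
    (h2 : |w.im| ≤ 1 / 2) : GaussianInt.toComplex e + w ≠ 0 := by
  intro h
  rw [mem_digits_iff, norm_eq] at he
  have hr : (e.re : ℝ) + w.re = 0 := by simpa using congrArg Complex.re h
  have hi : (e.im : ℝ) + w.im = 0 := by simpa using congrArg Complex.im h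
  have he' : (2 : ℝ) ≤ (e.re : ℝ) ^ 2 + (e.im : ℝ) ^ 2 := by exact_mod_cast he
  rw [abs_le] at h1 h2
  nlinarith

/-- Outside the unit discs around the units, in coordinates. -/
theorem unit_le_of_inv_mem {S : Set GaussianInt} {v : ℂ} (hv : v ≠ 0)
    (h : v⁻¹ ∈ closedRegion S) {c : GaussianInt} (hc : c.norm = 1) :
    1 ≤ (v.re - c.re) ^ 2 + (v.im - c.im) ^ 2 := by
  obtain ⟨h1, h2, -⟩ := h
  have hs : (star c).norm = 1 := by rw [norm_eq] at *; simpa using hc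
  have key := inv_side_sub hs hv
  have pos := re_sq_add_im_sq_pos hv
  have : 0 ≤ ((v.re - (star c).re) ^ 2 + (v.im + (star c).im) ^ 2 - 1) /
      (2 * (v.re ^ 2 + v.im ^ 2)) := by
    rw [← key]
    rw [abs_le] at h1 h2
    rcases norm_eq_one hs with h | h | h | h <;> rw [h] <;> push_cast <;> linarith
  rw [le_div_iff₀ (by positivity), zero_mul] at this
  simp only [Zsqrtd.re_star, Zsqrtd.im_star, Int.cast_neg] at this
  linarith

theorem diag_le_of_inv_mem {S : Set GaussianInt} {v : ℂ} (hv : v ≠ 0)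
    (h : v⁻¹ ∈ closedRegion S) {c : GaussianInt} (hc : c.norm = 2) (hcS : star c ∈ S) :
    1 ≤ (v.re - c.re) ^ 2 + (v.im - c.im) ^ 2 := by
  have hs : (star c).norm = 2 := by rw [norm_eq] at *; simpa using hc
  have key := inv_diag_sub hs hv
  have pos := re_sq_add_im_sq_pos hv
  have : 0 ≤ ((v.re - (star c).re) ^ 2 + (v.im + (star c).im) ^ 2 - 1) /
      (v.re ^ 2 + v.im ^ 2) := by
    rw [← key]
    linarith [h.2.2 _ hcS]
  rw [le_div_iff₀ (by positivity), zero_mul] at this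
  simp only [Zsqrtd.re_star, Zsqrtd.im_star, Int.cast_neg] at this
  linarith

theorem half_plane_of_inv_mem {S : Set GaussianInt} {v : ℂ} (hv : v ≠ 0)
    (h : v⁻¹ ∈ closedRegion S) {c : GaussianInt} (hc : c.norm = 1) (hcS : c ∈ S) :
    c.re * v.re - c.im * v.im ≤ 1 / 2 := by
  have key := inv_unit_sub hc hv
  have pos := re_sq_add_im_sq_pos hv
  have : 0 ≤ (1 - 2 * (c.re * v.re - c.im * v.im)) / (v.re ^ 2 + v.im ^ 2) := by
    rw [← key]
    linarith [h.2.2 _ hcS]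
  rw [le_div_iff₀ (by positivity), zero_mul] at this
  linarith

/-- Every centre in `step S e` comes from a side of the square or from a diagonal disc of `S`. The
units in `S` only give half-planes, which `step` does not record, so this direction needs no
admissibility. -/
theorem mem_closedRegion_step {S : Set GaussianInt} {e : GaussianInt} (he : e ∈ digits) {w : ℂ}
    (h1 : |w.re| ≤ 1 / 2) (h2 : |w.im| ≤ 1 / 2)
    (h : (GaussianInt.toComplex e + w)⁻¹ ∈ closedRegion S) : w ∈ closedRegion (step S e) := by
  refine ⟨h1, h2, fun c hc => ?_⟩
  have hv := add_ne_zero_of_digit he h1 h2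
  have key : 1 ≤ ((GaussianInt.toComplex e + w).re - (c + e).re) ^ 2 +
      ((GaussianInt.toComplex e + w).im - (c + e).im) ^ 2 := by
    rcases hc.2 with hc | hc
    · exact unit_le_of_inv_mem hv h hc
    · exact diag_le_of_inv_mem hv h hc.1 hc.2
  simp only [Complex.add_re, Complex.add_im, ← GaussianInt.intCast_re, ← GaussianInt.intCast_im,
    Zsqrtd.re_add, Zsqrtd.im_add, Int.cast_add] at key
  convert key using 2 <;> ring

/-- A point of the open square lies outside the unit disc around any Gaussian integer that is
neither `0` nor one of its eight neighbours. -/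
theorem one_lt_of_far {c : GaussianInt} (h0 : c ≠ 0) (h1 : c.norm ≠ 1) (h2 : c.norm ≠ 2) {w : ℂ}
    (hr : |w.re| < 1 / 2) (hi : |w.im| < 1 / 2) :
    1 < (w.re - c.re) ^ 2 + (w.im - c.im) ^ 2 := by
  have : 2 ≤ c.re ∨ c.re ≤ -2 ∨ 2 ≤ c.im ∨ c.im ≤ -2 := by
    by_contra! h
    obtain ⟨x, y⟩ := c
    rw [norm_eq] at h1 h2
    simp only at h h1 h2
    obtain ⟨a1, a2, a3, a4⟩ := h
    have b1 : x ≤ 1 := by omega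
    have b2 : -1 ≤ x := by omega
    have b3 : y ≤ 1 := by omega
    have b4 : -1 ≤ y := by omega
    interval_cases x <;> interval_cases y <;> simp_all
    exact h0 rfl
  rw [abs_lt] at hr hi
  rcases this with h | h | h | h
  · have : (2 : ℝ) ≤ c.re := by exact_mod_cast h
    nlinarith [sq_nonneg (w.im - c.im)]
  · have : (c.re : ℝ) ≤ -2 := by exact_mod_cast h
    nlinarith [sq_nonneg (w.im - c.im)]
  · have : (2 : ℝ) ≤ c.im := by exact_mod_cast h
    nlinarith [sq_nonneg (w.re - c.re)]
  · have : (c.im : ℝ) ≤ -2 := by exact_mod_cast h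
    nlinarith [sq_nonneg (w.re - c.re)]

/-- The converse transition, where admissibility enters twice: it makes each half-plane coming from
a unit in `S` contain the whole translated open square, and it prevents the disc around `e` itself,
which would cover that square, from being removed. -/
theorem inv_mem_openRegion {S : Set GaussianInt} (hS : ∀ c ∈ S, c.norm = 1 ∨ c.norm = 2)
    {e : GaussianInt} (he : e ∈ digits) (hadm : Admissible S e) {w : ℂ}
    (hw : w ∈ openRegion (step S e)) : (GaussianInt.toComplex e + w)⁻¹ ∈ openRegion S := by
  obtain ⟨hr, hi, hw⟩ := hw
  have hv := add_ne_zero_of_digit he hr.le hi.le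
  have pos := re_sq_add_im_sq_pos hv
  have he2 := (mem_digits_iff e).1 he
  have out : ∀ s : GaussianInt, s ≠ e → (s.norm = 1 ∨ s.norm = 2 ∧ star s ∈ S) →
      1 < ((GaussianInt.toComplex e + w).re - s.re) ^ 2 +
        ((GaussianInt.toComplex e + w).im - s.im) ^ 2 := by
    intro s hse hs
    have key : 1 < (w.re - (s - e).re) ^ 2 + (w.im - (s - e).im) ^ 2 := by
      by_cases hc : (s - e).norm = 1 ∨ (s - e).norm = 2
      · exact hw _ ⟨hc, by simpa using hs⟩
      · push Not at hc
        exact one_lt_of_far (sub_ne_zero.2 hse) hc.1 hc.2 hr hi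
    simp only [Complex.add_re, Complex.add_im, ← GaussianInt.intCast_re,
      ← GaussianInt.intCast_im, Zsqrtd.re_sub, Zsqrtd.im_sub, Int.cast_sub] at key ⊢
    convert key using 2 <;> ring
  have side : ∀ c : GaussianInt, c.norm = 1 →
      c.re * (GaussianInt.toComplex e + w)⁻¹.re + c.im * (GaussianInt.toComplex e + w)⁻¹.im
        < 1 / 2 := by
    intro c hc
    have hs : (star c).norm = 1 := by rw [norm_eq] at *; simpa using hc
    have h := out (star c) (by rintro rfl; omega) (Or.inl hs)
    simp only [Zsqrtd.re_star, Zsqrtd.im_star, Int.cast_neg, sub_neg_eq_add] at h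
    rw [← sub_pos, inv_side_sub hc hv]
    exact div_pos (by linarith) (by linarith)
  have s1 := side ⟨1, 0⟩ (by decide)
  have s2 := side ⟨-1, 0⟩ (by decide)
  have s3 := side ⟨0, 1⟩ (by decide)
  have s4 := side ⟨0, -1⟩ (by decide)
  push_cast at s1 s2 s3 s4
  refine ⟨abs_lt.2 ⟨by linarith, by linarith⟩, abs_lt.2 ⟨by linarith, by linarith⟩,
    fun c hc => ?_⟩
  rw [← sub_pos]
  rcases hS c hc with h | h
  · rw [inv_unit_sub h hv]
    refine div_pos ?_ pos
    have hh := hadm.1 c hc h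
    rw [abs_lt] at hr hi
    have h3 : (c.re : ℝ) * e.re - c.im * e.im ≤ 0 := by
      have : c.re * e.re - c.im * e.im ≤ 0 := by simpa [sub_eq_add_neg] using hh
      exact_mod_cast this
    have h4 : (c.re : ℝ) * w.re - c.im * w.im < 1 / 2 := by
      rcases norm_eq_one h with h | h | h | h <;> rw [h] <;> push_cast <;> linarith
    simp only [Complex.add_re, Complex.add_im, ← GaussianInt.intCast_re,
      ← GaussianInt.intCast_im]
    linarith
  · have hs : (star c).norm = 2 := by rw [norm_eq] at *; simpa using h
    have := out (star c) (by rintro rfl; exact hadm.2 (by simpa using hc))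
      (Or.inr ⟨hs, by simpa using hc⟩)
    rw [inv_diag_sub h hv]
    simp only [Zsqrtd.re_star, Zsqrtd.im_star, Int.cast_neg, sub_neg_eq_add] at this
    exact div_pos (by linarith) pos

/-! ### Star-shaped regions and full states -/

/-- The square of `|(1-t)(w-c) + t(p-c)|` expands with weights `(1-t)²`, `2t(1-t)`, `t²` summing to
`1`; the three factors are at least `1`, the last two strictly. -/
theorem mem_openRegion_of_star {T : Set GaussianInt} {p : ℂ} (hr : |p.re| < 1 / 2)
    (hi : |p.im| < 1 / 2) (hp : ∀ c ∈ T, 1 < (p.re - c.re) ^ 2 + (p.im - c.im) ^ 2)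
    (hT : ∀ w ∈ closedRegion T, ∀ c ∈ T,
      1 < (w.re - c.re) * (p.re - c.re) + (w.im - c.im) * (p.im - c.im))
    {w : ℂ} (hw : w ∈ closedRegion T) {t : ℝ} (h0 : 0 < t) (h1 : t < 1) :
    w + (t : ℂ) * (p - w) ∈ openRegion T := by
  obtain ⟨wr, wi, wc⟩ := hw
  rw [abs_le] at wr wi
  rw [abs_lt] at hr hi
  simp only [openRegion, Set.mem_ofPred_eq, Complex.add_re, Complex.add_im, Complex.re_ofReal_mul,
    Complex.im_ofReal_mul, Complex.sub_re, Complex.sub_im]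
  refine ⟨abs_lt.2 ⟨by nlinarith, by nlinarith⟩, abs_lt.2 ⟨by nlinarith, by nlinarith⟩,
    fun c hc => ?_⟩
  have a1 := mul_pos (mul_pos h0 h0) (sub_pos.2 (hp c hc))
  have a2 := mul_pos (mul_pos h0 (sub_pos.2 h1))
    (sub_pos.2 (hT w ⟨abs_le.2 wr, abs_le.2 wi, wc⟩ c hc))
  have a3 := mul_nonneg (mul_self_nonneg (1 - t)) (sub_nonneg.2 (wc c hc))
  linear_combination a1 + 2 * a2 + a3

theorem closedRegion_subset_closure_of_star {T : Set GaussianInt} {p : ℂ} (hr : |p.re| < 1 / 2)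
    (hi : |p.im| < 1 / 2) (hp : ∀ c ∈ T, 1 < (p.re - c.re) ^ 2 + (p.im - c.im) ^ 2)
    (hT : ∀ w ∈ closedRegion T, ∀ c ∈ T,
      1 < (w.re - c.re) * (p.re - c.re) + (w.im - c.im) * (p.im - c.im)) :
    closedRegion T ⊆ closure (openRegion T) := by
  intro w hw
  have lim : Filter.Tendsto (fun t : ℝ => w + (t : ℂ) * (p - w)) (nhdsWithin 0 (Set.Ioi 0))
      (nhds w) := by
    have : Continuous (fun t : ℝ => w + (t : ℂ) * (p - w)) := by fun_prop
    simpa using (this.tendsto 0).mono_left nhdsWithin_le_nhds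
  refine mem_closure_of_tendsto lim ?_
  filter_upwards [Ioo_mem_nhdsGT (zero_lt_one' ℝ)] with t ht
  exact mem_openRegion_of_star hr hi hp hT hw ht.1 ht.2

theorem unit_star_bound {X y s : ℝ} (hX : 1 / 2 ≤ X) (hy : |y| ≤ 1 / 2) (hs : |s| ≤ 1)
    (h : 1 ≤ X ^ 2 + y ^ 2) : 1 < X * (7 / 5) + y * (2 / 5 * s) := by
  have h1 : |y * s| ≤ 1 / 2 := by
    rw [abs_mul]
    nlinarith [abs_nonneg y, abs_nonneg s]
  rw [abs_le] at hy h1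
  -- `X ≥ √3/2 > 0.86`, and `0.86 · 7/5 - 1/5 = 1.004`, so `2/5` leaves just enough room.
  have h2 : 0.86 ≤ X := by nlinarith
  linarith

theorem diag_star_bound {X Y s t : ℝ} (hX : 1 / 2 ≤ X) (hY : 1 / 2 ≤ Y) (hs : 0 ≤ s)
    (ht : 0 ≤ t) (hst : 1 ≤ s + t) : 1 < X * (1 + 2 / 5 * s) + Y * (1 + 2 / 5 * t) := by
  nlinarith

theorem abs_sign_le (m : ℤ) : |((m.sign : ℤ) : ℝ)| ≤ 1 := by
  rcases lt_trichotomy m 0 with h | rfl | h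
  · simp [Int.sign_eq_neg_one_of_neg h]
  · simp
  · simp [Int.sign_eq_one_of_pos h]

theorem sign_nonneg_of_sum {m n : ℤ} (hm : 0 ≤ m) (hn : 0 ≤ n) (h : 1 ≤ m + n) :
    0 ≤ ((m.sign : ℤ) : ℝ) ∧ 0 ≤ ((n.sign : ℤ) : ℝ) ∧
      1 ≤ ((m.sign : ℤ) : ℝ) + ((n.sign : ℤ) : ℝ) := by
  rcases hm.eq_or_lt with rfl | hm
  · simp [Int.sign_eq_one_of_pos (show 0 < n by omega)]
  · rcases hn.eq_or_lt with rfl | hn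
    · simp [Int.sign_eq_one_of_pos hm]
    · norm_num [Int.sign_eq_one_of_pos hm, Int.sign_eq_one_of_pos hn]

/-- A point around which the region of `step S e` is star-shaped. -/
noncomputable def starCenter (e : GaussianInt) : ℂ :=
  ⟨2 / 5 * ((e.re.sign : ℤ) : ℝ), 2 / 5 * ((e.im.sign : ℤ) : ℝ)⟩

theorem starCenter_lt (e : GaussianInt) :
    |(starCenter e).re| < 1 / 2 ∧ |(starCenter e).im| < 1 / 2 := by
  have h1 := abs_sign_le e.re
  have h2 := abs_sign_le e.im
  simp only [starCenter, abs_mul]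
  norm_num
  constructor <;> linarith

/-- Since `|c + e|² ≤ 2 ≤ |e|²`, the centre `c` points away from `e`, while `starCenter e` is moved
from `0` towards `e`. -/
theorem star_step {S : Set GaussianInt} {e : GaussianInt} (he : e ∈ digits) {w : ℂ}
    (hr : |w.re| ≤ 1 / 2) (hi : |w.im| ≤ 1 / 2) {c : GaussianInt} (hc : c ∈ step S e)
    (hw : 1 ≤ (w.re - c.re) ^ 2 + (w.im - c.im) ^ 2) :
    1 < (w.re - c.re) * ((starCenter e).re - c.re) +
      (w.im - c.im) * ((starCenter e).im - c.im) := by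
  rw [mem_digits_iff, norm_eq] at he
  have hce : (c + e).norm ≤ 2 := by rcases hc.2 with h | h <;> omega
  rw [norm_eq] at hce
  have s1 := abs_sign_le e.re
  have s2 := abs_sign_le e.im
  have hr' := abs_le.1 hr
  have hi' := abs_le.1 hi
  simp only [starCenter]
  rcases hc.1 with h | h
  · rcases norm_eq_one h with rfl | rfl | rfl | rfl <;>
      simp only [Zsqrtd.re_add, Zsqrtd.im_add] at hce <;> push_cast at hw ⊢
    · rw [Int.sign_eq_neg_one_of_neg (show e.re < 0 by nlinarith)]
      have := unit_star_bound (X := 1 - w.re) (by linarith) hi s2 (by linarith)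
      push_cast
      linarith
    · rw [Int.sign_eq_one_of_pos (show 0 < e.re by nlinarith)]
      have := unit_star_bound (X := 1 + w.re) (by linarith) hi s2 (by linarith)
      push_cast
      linarith
    · rw [Int.sign_eq_neg_one_of_neg (show e.im < 0 by nlinarith)]
      have := unit_star_bound (X := 1 - w.im) (by linarith) hr s1 (by linarith)
      push_cast
      linarith
    · rw [Int.sign_eq_one_of_pos (show 0 < e.im by nlinarith)]
      have := unit_star_bound (X := 1 + w.im) (by linarith) hr s1 (by linarith)
      push_cast
      linarith
  · have neg_cast : ∀ m : ℤ, (((-m).sign : ℤ) : ℝ) = -((m.sign : ℤ) : ℝ) := by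
      intro m; rw [Int.sign_neg]; push_cast; rfl
    rcases norm_eq_two h with rfl | rfl | rfl | rfl <;>
      simp only [Zsqrtd.re_add, Zsqrtd.im_add] at hce <;> push_cast at hw ⊢
    · obtain ⟨a1, a2, a3⟩ := sign_nonneg_of_sum (m := -e.re) (n := -e.im) (by nlinarith)
        (by nlinarith) (by nlinarith)
      rw [neg_cast] at a1 a3
      rw [neg_cast] at a2 a3
      have := diag_star_bound (X := 1 - w.re) (Y := 1 - w.im) (by linarith) (by linarith) a1 a2 a3
      linarith
    · obtain ⟨a1, a2, a3⟩ := sign_nonneg_of_sum (m := -e.re) (n := e.im) (by nlinarith)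
        (by nlinarith) (by nlinarith)
      rw [neg_cast] at a1 a3
      have := diag_star_bound (X := 1 - w.re) (Y := 1 + w.im) (by linarith) (by linarith) a1 a2 a3
      linarith
    · obtain ⟨a1, a2, a3⟩ := sign_nonneg_of_sum (m := e.re) (n := -e.im) (by nlinarith)
        (by nlinarith) (by nlinarith)
      rw [neg_cast] at a2 a3
      have := diag_star_bound (X := 1 + w.re) (Y := 1 - w.im) (by linarith) (by linarith) a1 a2 a3
      linarith
    · obtain ⟨a1, a2, a3⟩ := sign_nonneg_of_sum (m := e.re) (n := e.im) (by nlinarith)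
        (by nlinarith) (by nlinarith)
      have := diag_star_bound (X := 1 + w.re) (Y := 1 + w.im) (by linarith) (by linarith) a1 a2 a3
      linarith

/-- With `p = starCenter e`, expand `|p - c|² = |p|² - 2⟨p, c⟩ + |c|²`, where `p ≠ 0`, `⟨p, c⟩ ≤ 0`
and `|c| ≥ 1`. -/
theorem one_lt_starCenter {S : Set GaussianInt} {e : GaussianInt} (he : e ∈ digits)
    {c : GaussianInt} (hc : c ∈ step S e) :
    1 < ((starCenter e).re - c.re) ^ 2 + ((starCenter e).im - c.im) ^ 2 := by
  have hlt := starCenter_lt e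
  rw [mem_digits_iff, norm_eq] at he
  have hce : (c + e).norm ≤ 2 := by rcases hc.2 with h | h <;> omega
  have hc2 : 1 ≤ c.norm := by rcases hc.1 with h | h <;> omega
  rw [norm_eq] at hce hc2
  simp only [Zsqrtd.re_add, Zsqrtd.im_add] at hce
  have key : c.re * e.re.sign + c.im * e.im.sign ≤ 0 := by
    rcases hc.1 with h | h
    · rcases norm_eq_one h with rfl | rfl | rfl | rfl <;> simp only at hce ⊢
      · rw [Int.sign_eq_neg_one_of_neg (show e.re < 0 by nlinarith)]; simp
      · rw [Int.sign_eq_one_of_pos (show 0 < e.re by nlinarith)]; simp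
      · rw [Int.sign_eq_neg_one_of_neg (show e.im < 0 by nlinarith)]; simp
      · rw [Int.sign_eq_one_of_pos (show 0 < e.im by nlinarith)]; simp
    · have n1 : ∀ m : ℤ, 0 ≤ m → 0 ≤ m.sign := fun m => Int.sign_nonneg_iff.2
      have n2 : ∀ m : ℤ, m ≤ 0 → m.sign ≤ 0 := fun m => Int.sign_nonpos_iff.2
      rcases norm_eq_two h with rfl | rfl | rfl | rfl <;> simp only at hce ⊢
      · linarith [n2 e.re (by nlinarith), n2 e.im (by nlinarith)]
      · linarith [n2 e.re (by nlinarith), n1 e.im (by nlinarith)]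
      · linarith [n1 e.re (by nlinarith), n2 e.im (by nlinarith)]
      · linarith [n1 e.re (by nlinarith), n1 e.im (by nlinarith)]
  have h0 : e.re ≠ 0 ∨ e.im ≠ 0 := by
    by_contra! h
    rw [h.1, h.2] at he
    norm_num at he
  have pos : 0 < (starCenter e).re ^ 2 + (starCenter e).im ^ 2 := by
    simp only [starCenter]
    rcases h0 with h | h
    · have : ((e.re.sign : ℤ) : ℝ) ≠ 0 := by simpa using h
      positivity
    · have : ((e.im.sign : ℤ) : ℝ) ≠ 0 := by simpa using h
      positivity
  have key' : (c.re : ℝ) * e.re.sign + c.im * e.im.sign ≤ 0 := by exact_mod_cast key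
  have hc2' : (1 : ℝ) ≤ (c.re : ℝ) ^ 2 + (c.im : ℝ) ^ 2 := by exact_mod_cast hc2
  have : c.re * (starCenter e).re + c.im * (starCenter e).im ≤ 0 := by
    simp only [starCenter]; linarith
  linarith

/-- A state is full if its closed region is the closure of its non-empty open region. -/
def IsFull (S : Set GaussianInt) : Prop :=
  (openRegion S).Nonempty ∧ closedRegion S ⊆ closure (openRegion S)

theorem isFull_step (S : Set GaussianInt) {e : GaussianInt} (he : e ∈ digits) :
    IsFull (step S e) := by
  obtain ⟨hr, hi⟩ := starCenter_lt e
  exact ⟨⟨_, hr, hi, fun c hc => one_lt_starCenter he hc⟩,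
    closedRegion_subset_closure_of_star hr hi (fun c hc => one_lt_starCenter he hc)
      fun w hw c hc => star_step he hw.1 hw.2.1 hc (hw.2.2 c hc)⟩

theorem isFull_empty : IsFull ∅ := by
  have h : (0 : ℂ) ∈ openRegion ∅ := by simp [openRegion]
  exact ⟨⟨_, h⟩, closedRegion_subset_closure_of_star (p := 0) (by simp) (by simp) (by simp)
    (by simp)⟩

theorem isOpen_openRegion {S : Set GaussianInt} (hS : ∀ c ∈ S, c.norm = 1 ∨ c.norm = 2) :
    IsOpen (openRegion S) := by
  have fin : S.Finite := by
    refine Set.Finite.subset (Set.toFinite ({⟨1, 0⟩, ⟨-1, 0⟩, ⟨0, 1⟩, ⟨0, -1⟩, ⟨1, 1⟩, ⟨1, -1⟩,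
      ⟨-1, 1⟩, ⟨-1, -1⟩} : Set GaussianInt)) fun c hc => ?_
    rcases hS c hc with h | h
    · rcases norm_eq_one h with h | h | h | h <;> simp [h]
    · rcases norm_eq_two h with h | h | h | h <;> simp [h]
  have : openRegion S = {w : ℂ | |w.re| < 1 / 2} ∩ ({w : ℂ | |w.im| < 1 / 2} ∩
      ⋂ c ∈ S, {w : ℂ | 1 < (w.re - c.re) ^ 2 + (w.im - c.im) ^ 2}) := by
    ext w
    simp [openRegion]
  rw [this]
  refine (isOpen_lt (by fun_prop) (by fun_prop)).inter
    ((isOpen_lt (by fun_prop) (by fun_prop)).inter ?_)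
  exact fin.isOpen_biInter fun c _ => isOpen_lt (by fun_prop) (by fun_prop)

/-- Otherwise the open unit disc around `e` would be removed, yet `|w|² ≤ 1/2` puts `e + w` inside
it. -/
theorem star_notMem {S : Set GaussianInt} (hS : ∀ c ∈ S, c.norm = 1 ∨ c.norm = 2)
    {e : GaussianInt} (he : e ∈ digits) {w : ℂ} (h1 : |w.re| ≤ 1 / 2) (h2 : |w.im| ≤ 1 / 2)
    (h : (GaussianInt.toComplex e + w)⁻¹ ∈ closedRegion S) : star e ∉ S := by
  intro hs
  have he2 := (mem_digits_iff e).1 he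
  have hn : (star e).norm = e.norm := by rw [norm_eq, norm_eq]; simp
  have hn2 : e.norm = 2 := by rcases hS _ hs with h | h <;> omega
  have := diag_le_of_inv_mem (add_ne_zero_of_digit he h1 h2) h hn2 hs
  simp only [Complex.add_re, Complex.add_im, ← GaussianInt.intCast_re,
    ← GaussianInt.intCast_im, add_sub_cancel_left] at this
  rw [abs_le] at h1 h2
  nlinarith

/-! ### Digits confined to a side of the square -/

theorem supNorm_toComplex (e : GaussianInt) :
    supNorm (GaussianInt.toComplex e) = max |(e.re : ℝ)| |(e.im : ℝ)| := by
  simp [supNorm]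

/-- On the line `Re = 1/2`, the exterior of the unit discs around `±i` is far from the real
axis. -/
theorem two_le_abs_of_side {k : ℤ} {t y : ℝ} (ht : |t| = 1 / 2) (hy : |y - k| ≤ 1 / 2)
    (h0 : 1 ≤ (|t| - 1) ^ 2 + y ^ 2)
    (h1 : 1 ≤ t ^ 2 + (y - 1) ^ 2) (h2 : 1 ≤ t ^ 2 + (y + 1) ^ 2) : 2 ≤ k ∨ k ≤ -2 := by
  have ht2 : t ^ 2 = 1 / 4 := by rw [← sq_abs, ht]; norm_num
  rw [ht] at h0
  rw [ht2] at h1 h2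
  rw [abs_le] at hy
  by_contra! h
  have k1 : (k : ℝ) ≤ 1 := by exact_mod_cast (by omega : k ≤ 1)
  have k2 : (-1 : ℝ) ≤ k := by exact_mod_cast (by omega : -1 ≤ k)
  rcases le_total 0 y with hy0 | hy0
  -- `h0` excludes small `y`, and `k ≤ 1` gives `y ≤ 3/2`; so `|y - 1| ≤ 1/2`, against `h1`.
  · have : 0.5 < y := by nlinarith
    nlinarith
  · have : y < -0.5 := by nlinarith
    nlinarith

/-- The half-plane `Re ≤ 1/2` meets a closed square centred at real part `m ≥ 1` only when `m = 1`,
and then only in its left side; the discs around the units then force `|k| ≥ 2`. -/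
theorem side_digit {m k : ℤ} {x y : ℝ} (hm : 0 < m) (hx : |x| ≤ 1 / 2) (hy : |y| ≤ 1 / 2)
    (hp : (m : ℝ) + x ≤ 1 / 2) (h0 : 1 ≤ ((m + x : ℝ) - 1) ^ 2 + (k + y : ℝ) ^ 2)
    (h1 : 1 ≤ (m + x : ℝ) ^ 2 + ((k + y : ℝ) - 1) ^ 2)
    (h2 : 1 ≤ (m + x : ℝ) ^ 2 + ((k + y : ℝ) + 1) ^ 2) :
    m = 1 ∧ x = -1 / 2 ∧ (2 ≤ k ∨ k ≤ -2) := by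
  have hx' := abs_le.1 hx
  have hm1 : m = 1 := by
    have : (m : ℝ) < 2 := by linarith
    have : m < 2 := by exact_mod_cast this
    omega
  subst hm1
  rw [Int.cast_one] at *
  have hx1 : x = -1 / 2 := by linarith
  subst hx1
  have ht : |(1 + -1 / 2 : ℝ)| = 1 / 2 := by norm_num [abs_of_pos]
  exact ⟨rfl, rfl, two_le_abs_of_side ht (by simpa using hy) (by rw [ht]; linarith) h1 h2⟩

theorem nonpos_of_add_le {k : ℤ} {y : ℝ} (hy : |y| ≤ 1 / 2) (h : (k : ℝ) + y ≤ 1 / 2)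
    (hk : 2 ≤ k ∨ k ≤ -2) : k ≤ 0 := by
  have := abs_le.1 hy
  have h2 : (k : ℝ) ≤ 1 := by linarith
  have : k ≤ 1 := by exact_mod_cast h2
  omega

theorem max_abs_unit {k : ℤ} (hk : 2 ≤ k ∨ k ≤ -2) : (1 : ℝ) ≤ |(k : ℝ)| := by
  rcases hk with h | h
  · have : (2 : ℝ) ≤ k := by exact_mod_cast h
    exact le_trans (by linarith) (le_abs_self _)
  · have : (k : ℝ) ≤ -2 := by exact_mod_cast h
    exact le_trans (by linarith) (neg_le_abs _)

/-- If a digit leaves the open region then all points with that digit lie on one side of the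
square, and the digit across that side has the same sup norm and is admissible. -/
theorem exists_digit_across {S : Set GaussianInt} (hS : ∀ c ∈ S, c.norm = 1 ∨ c.norm = 2)
    {e : GaussianInt} (he : e ∈ digits) {W : Set ℂ} (hW : W.Nonempty)
    (hsq : ∀ w ∈ W, |w.re| ≤ 1 / 2 ∧ |w.im| ≤ 1 / 2 ∧
      (GaussianInt.toComplex e + w)⁻¹ ∈ closedRegion S) (hadm : ¬ Admissible S e) :
    ∃ c : GaussianInt, c.norm = 1 ∧ e - star c ∈ digits ∧ Admissible S (e - star c) ∧
      supNorm (GaussianInt.toComplex (e - star c)) = supNorm (GaussianInt.toComplex e) ∧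
      ∀ w ∈ W, (c.re : ℝ) * w.re - c.im * w.im = -1 / 2 := by
  obtain ⟨w₀, hw₀⟩ := hW
  have hstar : star e ∉ S :=
    star_notMem hS he (hsq _ hw₀).1 (hsq _ hw₀).2.1 (hsq _ hw₀).2.2
  obtain ⟨c, hcS, hc, hce⟩ : ∃ c ∈ S, c.norm = 1 ∧ 0 < (c * e).re := by
    by_contra! h
    exact hadm ⟨h, hstar⟩
  have units : ∀ w ∈ W, ∀ s : GaussianInt, s.norm = 1 →
      1 ≤ ((e.re + w.re : ℝ) - s.re) ^ 2 + ((e.im + w.im : ℝ) - s.im) ^ 2 := by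
    intro w hw s hs
    obtain ⟨a, b, h⟩ := hsq w hw
    have := unit_le_of_inv_mem (add_ne_zero_of_digit he a b) h hs
    simpa only [Complex.add_re, Complex.add_im, ← GaussianInt.intCast_re,
      ← GaussianInt.intCast_im] using this
  have half : ∀ w ∈ W, ∀ s ∈ S, s.norm = 1 →
      s.re * (e.re + w.re : ℝ) - s.im * (e.im + w.im : ℝ) ≤ 1 / 2 := by
    intro w hw s hsS hs
    obtain ⟨a, b, h⟩ := hsq w hw
    have := half_plane_of_inv_mem (add_ne_zero_of_digit he a b) h hs hsS
    simpa only [Complex.add_re, Complex.add_im, ← GaussianInt.intCast_re,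
      ← GaussianInt.intCast_im] using this
  have core : ∀ w ∈ W, (c * e).re = 1 ∧ (c.re : ℝ) * w.re - c.im * w.im = -1 / 2 ∧
      (2 ≤ (c * e).im ∨ (c * e).im ≤ -2) := by
    intro w hw
    obtain ⟨hr, hi, -⟩ := hsq w hw
    have U1 := units w hw ⟨1, 0⟩ (by decide)
    have U2 := units w hw ⟨-1, 0⟩ (by decide)
    have U3 := units w hw ⟨0, 1⟩ (by decide)
    have U4 := units w hw ⟨0, -1⟩ (by decide)
    have H := half w hw c hcS hc
    have hr' : |-w.re| ≤ 1 / 2 := by rwa [abs_neg]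
    have hi' : |-w.im| ≤ 1 / 2 := by rwa [abs_neg]
    rcases norm_eq_one hc with rfl | rfl | rfl | rfl <;>
      simp only [Zsqrtd.re_mul, Zsqrtd.im_mul] at hce ⊢ <;> push_cast at H U1 U2 U3 U4
    · obtain ⟨a, b, d⟩ := side_digit (m := e.re) (k := e.im) (by linarith) hr hi (by linarith)
        (by linarith) (by linarith) (by linarith)
      refine ⟨by linarith, by push_cast; linarith, by omega⟩
    · obtain ⟨a, b, d⟩ := side_digit (m := -e.re) (k := e.im) (x := -w.re) (by linarith) hr' hi
        (by push_cast; linarith) (by push_cast; linarith) (by push_cast; linarith)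
        (by push_cast; linarith)
      refine ⟨by linarith, by push_cast; linarith, by omega⟩
    · obtain ⟨a, b, d⟩ := side_digit (m := -e.im) (k := e.re) (x := -w.im) (by linarith) hi' hr
        (by push_cast; linarith) (by push_cast; linarith) (by push_cast; linarith)
        (by push_cast; linarith)
      refine ⟨by linarith, by push_cast; linarith, by omega⟩
    · obtain ⟨a, b, d⟩ := side_digit (m := e.im) (k := e.re) (by linarith) hi hr (by linarith)
        (by linarith) (by linarith) (by linarith)
      refine ⟨by linarith, by push_cast; linarith, by omega⟩
  obtain ⟨hre, -, hk2⟩ := core w₀ hw₀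
  obtain ⟨k, hk⟩ : ∃ k, k = (c * e).im := ⟨_, rfl⟩
  rw [← hk] at hk2
  -- Here `c * e = 1 + k i`, so `e - star c = k i * star c`.
  have hnorm : (e - star c).norm = k ^ 2 := by
    rw [norm_eq]
    rcases norm_eq_one hc with rfl | rfl | rfl | rfl <;>
      simp only [Zsqrtd.re_mul, Zsqrtd.im_mul, Zsqrtd.re_sub, Zsqrtd.im_sub, Zsqrtd.re_star,
        Zsqrtd.im_star] at hre hk ⊢ <;> subst hk
    · rw [show e.re = 1 by linarith]; ring
    · rw [show e.re = -1 by linarith]; ring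
    · rw [show e.im = -1 by linarith]; ring
    · rw [show e.im = 1 by linarith]; ring
  have hk4 : 4 ≤ k ^ 2 := by rcases hk2 with h | h <;> nlinarith
  refine ⟨c, hc, (mem_digits_iff _).2 (by omega), ⟨?_, ?_⟩, ?_, fun w hw => ?_⟩
  -- For `s = ±c` the real part is `0`. For `s` perpendicular to `c` it is `±k`; the half-plane of
  -- `s` bounds it by `1`, and `|k| ≥ 2` then makes it negative.
  · intro s hsS hs
    have H := half w₀ hw₀ s hsS hs
    rcases norm_eq_one hc with rfl | rfl | rfl | rfl <;>
      simp only [Zsqrtd.re_mul, Zsqrtd.im_mul] at hre hk <;> subst hk <;>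
      rcases norm_eq_one hs with rfl | rfl | rfl | rfl <;>
      simp only [Zsqrtd.re_mul, Zsqrtd.re_sub, Zsqrtd.im_sub, Zsqrtd.re_star,
        Zsqrtd.im_star] <;> push_cast at H <;>
      first
      | linarith
      | (have := nonpos_of_add_le (k := e.im) (y := w₀.im) (hsq _ hw₀).2.1 (by linarith)
          (by omega); linarith)
      | (have := nonpos_of_add_le (k := -e.im) (y := -w₀.im)
          (by rw [abs_neg]; exact (hsq _ hw₀).2.1) (by push_cast; linarith) (by omega); linarith)
      | (have := nonpos_of_add_le (k := e.re) (y := w₀.re) (hsq _ hw₀).1 (by linarith)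
          (by omega); linarith)
      | (have := nonpos_of_add_le (k := -e.re) (y := -w₀.re)
          (by rw [abs_neg]; exact (hsq _ hw₀).1) (by push_cast; linarith) (by omega); linarith)
  · intro h
    have hn := Zsqrtd.norm_conj (e - star c)
    rcases hS _ h with h | h <;> omega
  -- The coordinates of the digit change from `1, |k|` to `0, |k|` in absolute value, which leaves
  -- the maximum at `|k|`.
  · have hk1 := max_abs_unit hk2
    rw [supNorm_toComplex, supNorm_toComplex]
    rcases norm_eq_one hc with rfl | rfl | rfl | rfl <;>
      simp only [Zsqrtd.re_mul, Zsqrtd.im_mul, Zsqrtd.re_sub, Zsqrtd.im_sub, Zsqrtd.re_star,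
        Zsqrtd.im_star] at hre hk ⊢ <;> subst hk
    · rw [show e.re = 1 by linarith] at hk1 ⊢
      push_cast at hk1 ⊢
      norm_num [-GaussianInt.intCast_re, -GaussianInt.intCast_im] at hk1 ⊢
      exact hk1
    · rw [show e.re = -1 by linarith] at hk1 ⊢
      push_cast at hk1 ⊢
      norm_num [-GaussianInt.intCast_re, -GaussianInt.intCast_im] at hk1 ⊢
      exact hk1
    · rw [show e.im = -1 by linarith] at hk1 ⊢
      push_cast at hk1 ⊢
      norm_num [-GaussianInt.intCast_re, -GaussianInt.intCast_im] at hk1 ⊢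
      exact hk1
    · rw [show e.im = 1 by linarith] at hk1 ⊢
      push_cast at hk1 ⊢
      norm_num [-GaussianInt.intCast_re, -GaussianInt.intCast_im] at hk1 ⊢
      exact hk1
  · exact (core w hw).2.1

/-! ### The dihedral action -/

/-- The symmetry `z ↦ ε z` or `z ↦ ε (conj z)` of the square. -/
noncomputable def act (ε : GaussianInt) (b : Bool) (z : ℂ) : ℂ :=
  GaussianInt.toComplex ε * if b then conj z else z

/-- The restriction of `act` to the Gaussian integers. -/
def actInt (ε : GaussianInt) (b : Bool) (d : GaussianInt) : GaussianInt :=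
  ε * if b then star d else d

theorem act_toComplex_add (ε : GaussianInt) (b : Bool) (d : GaussianInt) (w : ℂ) :
    act ε b (GaussianInt.toComplex d + w) =
      GaussianInt.toComplex (actInt ε b d) + act ε b w := by
  cases b <;> simp [act, actInt, mul_add]

theorem toComplex_mul_star {ε : GaussianInt} (hε : ε.norm = 1) :
    GaussianInt.toComplex ε * conj (GaussianInt.toComplex ε) = 1 := by
  rw [Complex.mul_conj, ← GaussianInt.intCast_complex_norm, hε, Int.cast_one]

theorem act_inv {ε : GaussianInt} (hε : ε.norm = 1) (b : Bool) (z : ℂ) :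
    (act ε b z)⁻¹ = act (star ε) b z⁻¹ := by
  have h := inv_eq_of_mul_eq_one_right (toComplex_mul_star hε)
  cases b <;> simp [act, h, mul_comm]

theorem act_square {ε : GaussianInt} (hε : ε.norm = 1) (b : Bool) {z : ℂ}
    (h1 : |z.re| ≤ 1 / 2) (h2 : |z.im| ≤ 1 / 2) :
    |(act ε b z).re| ≤ 1 / 2 ∧ |(act ε b z).im| ≤ 1 / 2 := by
  rw [one_div] at *
  rcases norm_eq_one hε with rfl | rfl | rfl | rfl <;> cases b <;>
    simp only [act, GaussianInt.toComplex_def'] <;> constructor <;> simpa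

theorem norm_actInt {ε : GaussianInt} (hε : ε.norm = 1) (b : Bool) (d : GaussianInt) :
    (actInt ε b d).norm = d.norm := by
  cases b <;> simp [actInt, Zsqrtd.norm_mul, hε]

theorem supNorm_actInt {ε : GaussianInt} (hε : ε.norm = 1) (b : Bool) (d : GaussianInt) :
    supNorm (GaussianInt.toComplex (actInt ε b d)) = supNorm (GaussianInt.toComplex d) := by
  rw [supNorm_toComplex, supNorm_toComplex]
  rcases norm_eq_one hε with rfl | rfl | rfl | rfl <;> cases b <;>
    simp [actInt, -GaussianInt.intCast_re, -GaussianInt.intCast_im, max_comm]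

theorem act_act (δ ε : GaussianInt) (b : Bool) (z : ℂ) :
    act δ true (act ε b z) = act (δ * star ε) (!b) z := by
  cases b <;> simp [act, mul_assoc]

/-- After multiplication by `c` the side is `Re = -1/2`; there, adding `1` is the reflection `u ↦
-conj u`. -/
theorem add_star_eq_act {c : GaussianInt} (hc : c.norm = 1) {w : ℂ}
    (h : (c.re : ℝ) * w.re - c.im * w.im = -1 / 2) :
    w + GaussianInt.toComplex (star c) = act (-(star c) ^ 2) true w := by
  rcases norm_eq_one hc with rfl | rfl | rfl | rfl <;> push_cast at h <;>
    apply Complex.ext <;> simp [act, GaussianInt.toComplex_def', sq] <;> linarith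

theorem exists_act_of_mem {f : ℂ ≃ᵢ ℂ} (hf : f ∈ dihedralEight) :
    ∃ (ε : GaussianInt) (b : Bool), ε.norm = 1 ∧ ∀ z, f z = act ε b z := by
  induction hf using Subgroup.closure_induction with
  | mem g hg =>
    rcases hg with rfl | rfl
    · exact ⟨⟨0, 1⟩, false, by decide, fun z => by
        simp [rot_apply, act, GaussianInt.toComplex_def']⟩
    · exact ⟨1, true, by decide, fun z => by simp [mir_apply, act]⟩
  | one => exact ⟨1, false, by decide, fun z => by simp [act]⟩
  | mul g h _ _ ihg ihh =>
    obtain ⟨ε, b, hε, hg⟩ := ihg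
    obtain ⟨δ, b', hδ, hh⟩ := ihh
    cases b
    · refine ⟨ε * δ, b', by simp [Zsqrtd.norm_mul, hε, hδ], fun z => ?_⟩
      rw [IsometryEquiv.mul_apply, hg, hh]
      simp [act, mul_assoc]
    · refine ⟨ε * star δ, !b', by simp [Zsqrtd.norm_mul, hε, hδ], fun z => ?_⟩
      rw [IsometryEquiv.mul_apply, hg, hh, act_act]
  | inv g _ ih =>
    obtain ⟨ε, b, hε, hg⟩ := ih
    have h1 := toComplex_mul_star hε
    cases b
    · refine ⟨star ε, false, by rw [Zsqrtd.norm_conj, hε], fun z => ?_⟩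
      apply g.injective
      rw [IsometryEquiv.apply_inv_self, hg]
      simp [act, ← mul_assoc, h1]
    · refine ⟨ε, true, hε, fun z => ?_⟩
      apply g.injective
      rw [IsometryEquiv.apply_inv_self, hg]
      simp [act, ← mul_assoc, h1]

/-! ### Digit sequences and the shadowing induction -/

/-- The first `n` partial quotients of `z` exist and are the first `n` terms of `a`. -/
def HasDigits (a : ℕ → GaussianInt) (n : ℕ) (z : ℂ) : Prop :=
  ∀ j < n, gaussMap^[j] z ≠ 0 ∧ partialQuotient j z = a j

theorem hasDigits_succ (a : ℕ → GaussianInt) (n : ℕ) (z : ℂ) :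
    HasDigits a (n + 1) z ↔
      (z ≠ 0 ∧ nearest z⁻¹ = a 0) ∧ HasDigits (fun j => a (j + 1)) n (gaussMap z) := by
  constructor
  · exact fun h => ⟨by simpa [partialQuotient] using h 0 (Nat.succ_pos n),
      fun j hj => by simpa [partialQuotient] using h (j + 1) (Nat.succ_lt_succ hj)⟩
  · rintro ⟨h0, h⟩ (_ | j) hj
    · simpa [partialQuotient] using h0
    · simpa [partialQuotient] using h j (Nat.lt_of_succ_lt_succ hj)

theorem inv_eq_digit_add (z : ℂ) (hz : z ≠ 0) :
    z⁻¹ = GaussianInt.toComplex (nearest z⁻¹) + gaussMap z := by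
  rw [gaussMap, if_neg hz]; ring

theorem nearest_add (e : GaussianInt) {w : ℂ} (h1 : |w.re| < 1 / 2) (h2 : |w.im| < 1 / 2) :
    nearest (GaussianInt.toComplex e + w) = e := by
  rw [abs_lt] at h1 h2
  ext
  · simp only [nearest, Complex.add_re, ← GaussianInt.intCast_re, Int.floor_eq_iff]
    constructor <;> linarith
  · simp only [nearest, Complex.add_im, ← GaussianInt.intCast_im, Int.floor_eq_iff]
    constructor <;> linarith

theorem abs_le_of_mem_fundamentalSquare {z : ℂ} (hz : z ∈ fundamentalSquare) :
    |z.re| ≤ 1 / 2 ∧ |z.im| ≤ 1 / 2 := by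
  have hz : nearest z = 0 := hz
  have h1 : ⌊z.re + 1 / 2⌋ = 0 := congrArg Zsqrtd.re hz
  have h2 : ⌊z.im + 1 / 2⌋ = 0 := congrArg Zsqrtd.im hz
  rw [Int.floor_eq_iff] at h1 h2
  push_cast at h1 h2
  exact ⟨abs_le.2 ⟨by linarith, by linarith⟩, abs_le.2 ⟨by linarith, by linarith⟩⟩

theorem mem_fundamentalSquare {z : ℂ} (h1 : |z.re| < 1 / 2) (h2 : |z.im| < 1 / 2) :
    z ∈ fundamentalSquare := by
  have := nearest_add 0 h1 h2
  rwa [map_zero, zero_add] at this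

/-- The word `a` with the letter `e` put in front. -/
def prepend (e : GaussianInt) (a : ℕ → GaussianInt) : ℕ → GaussianInt
  | 0 => e
  | j + 1 => a j

/-- `O` is a non-empty open subset of the region of `S` whose points have digits `b`. -/
structure IsOpenPiece (S : Set GaussianInt) (b : ℕ → GaussianInt) (n : ℕ) (O : Set ℂ) : Prop where
  isOpen : IsOpen O
  nonempty : O.Nonempty
  subset : O ⊆ openRegion S
  hasDigits : ∀ z ∈ O, HasDigits b n z

theorem IsOpenPiece.prepend {S : Set GaussianInt} (hS : ∀ c ∈ S, c.norm = 1 ∨ c.norm = 2)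
    {e : GaussianInt} (he : e ∈ digits) (hadm : Admissible S e) {b : ℕ → GaussianInt} {n : ℕ}
    {O : Set ℂ} (hO : IsOpenPiece (step S e) b n O) :
    ∃ O', IsOpenPiece S (prepend e b) (n + 1) O' ∧
      ∀ w ∈ closure O, |w.re| ≤ 1 / 2 → |w.im| ≤ 1 / 2 →
        (GaussianInt.toComplex e + w)⁻¹ ∈ closure O' := by
  have hne : ∀ w ∈ O, GaussianInt.toComplex e + w ≠ 0 := fun w hw =>
    add_ne_zero_of_digit he (hO.subset hw).1.le (hO.subset hw).2.1.le
  have hmaps : ∀ w ∈ O, (GaussianInt.toComplex e + w)⁻¹ ∈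
      {z : ℂ | z ≠ 0 ∧ z⁻¹ - GaussianInt.toComplex e ∈ O} := fun w hw =>
    ⟨inv_ne_zero (hne w hw), by simpa using hw⟩
  refine ⟨{z | z ≠ 0 ∧ z⁻¹ - GaussianInt.toComplex e ∈ O}, ⟨?_, ?_, ?_, ?_⟩, ?_⟩
  · have hcont : ContinuousOn (fun z : ℂ => z⁻¹ - GaussianInt.toComplex e) {0}ᶜ :=
      continuousOn_inv₀.sub continuousOn_const
    exact hcont.isOpen_inter_preimage isOpen_compl_singleton hO.isOpen
  · obtain ⟨w, hw⟩ := hO.nonempty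
    exact ⟨_, hmaps w hw⟩
  · rintro z ⟨hz, hw⟩
    have := inv_mem_openRegion hS he hadm (hO.subset hw)
    simpa using this
  · rintro z ⟨hz, hw⟩
    have hn : nearest z⁻¹ = e := by
      have := nearest_add e (hO.subset hw).1 (hO.subset hw).2.1
      simpa using this
    have hT : gaussMap z = z⁻¹ - GaussianInt.toComplex e := by rw [gaussMap, if_neg hz, hn]
    rw [hasDigits_succ]
    refine ⟨⟨hz, hn⟩, ?_⟩
    rw [hT]
    exact hO.hasDigits _ hw
  · intro w hw h1 h2
    -- Continuity holds even when `w` is on the boundary of the square, so limit points of `O` are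
    -- carried along.
    have hcont : ContinuousAt (fun w : ℂ => (GaussianInt.toComplex e + w)⁻¹) w :=
      (continuousAt_const.add continuousAt_id).inv₀ (add_ne_zero_of_digit he h1 h2)
    have himage : (fun w : ℂ => (GaussianInt.toComplex e + w)⁻¹) '' O ⊆
        {z : ℂ | z ≠ 0 ∧ z⁻¹ - GaussianInt.toComplex e ∈ O} := by
      rintro _ ⟨w, hw, rfl⟩
      exact hmaps w hw
    exact closure_mono himage
      (mem_closure_image (f := fun w : ℂ => (GaussianInt.toComplex e + w)⁻¹) hcont hw)

/-- The first digit of the shadowing word, and the symmetry under which the tails are shadowed. -/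
theorem exists_shadow_digit {S : Set GaussianInt} (hS : ∀ c ∈ S, c.norm = 1 ∨ c.norm = 2)
    {d : GaussianInt} (hd : d ∈ digits) {ε : GaussianInt} (hε : ε.norm = 1) (b : Bool)
    {Z : Set ℂ} (hZne : Z.Nonempty) (hZ : ∀ z ∈ Z, act ε b z ∈ closedRegion S)
    (hZd : ∀ z ∈ Z, z ≠ 0 ∧ nearest z⁻¹ = d) :
    ∃ (e δ : GaussianInt) (b' : Bool), e ∈ digits ∧ Admissible S e ∧
      supNorm (GaussianInt.toComplex e) = supNorm (GaussianInt.toComplex d) ∧ δ.norm = 1 ∧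
      ∀ z ∈ Z, act ε b z = (GaussianInt.toComplex e + act δ b' (gaussMap z))⁻¹ := by
  have hε' : (star ε).norm = 1 := by rw [Zsqrtd.norm_conj, hε]
  have hinv : ∀ z ∈ Z, act ε b z = (GaussianInt.toComplex (actInt (star ε) b d) +
      act (star ε) b (gaussMap z))⁻¹ := by
    intro z hz
    obtain ⟨h0, h1⟩ := hZd z hz
    rw [← act_toComplex_add, ← h1, ← inv_eq_digit_add z h0, ← act_inv hε, inv_inv]
  have he : actInt (star ε) b d ∈ digits := by
    rw [mem_digits_iff, norm_actInt hε']; exact (mem_digits_iff d).1 hd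
  have hsup := supNorm_actInt hε' b d
  by_cases hadm : Admissible S (actInt (star ε) b d)
  · exact ⟨_, star ε, b, he, hadm, hsup, hε', hinv⟩
  · obtain ⟨c, hc, hed, hea, hes, hside⟩ := exists_digit_across hS he
      (W := (fun z => act (star ε) b (gaussMap z)) '' Z) (hZne.image _) (by
        rintro _ ⟨z, hz, rfl⟩
        obtain ⟨h1, h2⟩ := abs_le_of_mem_fundamentalSquare (gaussMap_mem z)
        obtain ⟨h3, h4⟩ := act_square hε' b h1 h2
        exact ⟨h3, h4, by rw [← hinv z hz]; exact hZ z hz⟩) hadm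
    refine ⟨_, -(star c) ^ 2 * star (star ε), !b, hed, hea, hes.trans hsup, ?_, fun z hz => ?_⟩
    · rw [Zsqrtd.norm_mul, Zsqrtd.norm_neg, sq, Zsqrtd.norm_mul, Zsqrtd.norm_conj,
        Zsqrtd.norm_conj, hε', hc]
      norm_num
    -- Regroup `e + w` as `(e - star c) + (w + star c)`, the second summand being the reflected
    -- tail.
    · rw [hinv z hz, ← act_act, ← add_star_eq_act hc (hside _ ⟨z, hz, rfl⟩), map_sub]
      congr 1
      ring

/-- Points with a common expansion lie, up to a symmetry of the square, in the closure of an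
open set of points with a common expansion whose digits have the same sup norms. -/
theorem exists_openPiece (n : ℕ) : ∀ (a : ℕ → GaussianInt), (∀ j < n, a j ∈ digits) →
    ∀ S : Set GaussianInt, (∀ c ∈ S, c.norm = 1 ∨ c.norm = 2) → IsFull S →
    ∀ ε : GaussianInt, ε.norm = 1 → ∀ (s : Bool) (Z : Set ℂ), Z.Nonempty →
    (∀ z ∈ Z, act ε s z ∈ closedRegion S) → (∀ z ∈ Z, HasDigits a n z) →
    ∃ b : ℕ → GaussianInt, (∀ j < n, b j ∈ digits ∧
        supNorm (GaussianInt.toComplex (a j)) = supNorm (GaussianInt.toComplex (b j))) ∧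
      ∃ O, IsOpenPiece S b n O ∧ ∀ z ∈ Z, act ε s z ∈ closure O := by
  induction n with
  | zero =>
    intro a _ S hS hfull ε _ s Z _ hZ _
    exact ⟨a, by simp, openRegion S, ⟨isOpen_openRegion hS, hfull.1, subset_rfl,
      fun z _ j hj => absurd hj (Nat.not_lt_zero j)⟩, fun z hz => hfull.2 (hZ z hz)⟩
  | succ n ih =>
    intro a ha S hS hfull ε hε s Z hZne hZ hZd
    obtain ⟨e, δ, s', he, hadm, hsup, hδ, hinv⟩ := exists_shadow_digit hS (ha 0 (Nat.succ_pos n))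
      hε s hZne hZ fun z hz => ((hasDigits_succ a n z).1 (hZd z hz)).1
    have hsq : ∀ z, |(act δ s' (gaussMap z)).re| ≤ 1 / 2 ∧ |(act δ s' (gaussMap z)).im| ≤ 1 / 2 := by
      intro z
      obtain ⟨h1, h2⟩ := abs_le_of_mem_fundamentalSquare (gaussMap_mem z)
      exact act_square hδ s' h1 h2
    obtain ⟨b, hb, O, hO, hcl⟩ := ih (fun j => a (j + 1)) (fun j hj => ha _ (Nat.succ_lt_succ hj))
      (step S e) (fun c hc => hc.1) (isFull_step S he) δ hδ s' (gaussMap '' Z) (hZne.image _)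
      (by
        rintro _ ⟨z, hz, rfl⟩
        exact mem_closedRegion_step he (hsq z).1 (hsq z).2 (by rw [← hinv z hz]; exact hZ z hz))
      (by
        rintro _ ⟨z, hz, rfl⟩
        exact ((hasDigits_succ a n z).1 (hZd z hz)).2)
    obtain ⟨O', hO', hcl'⟩ := hO.prepend hS he hadm
    refine ⟨prepend e b, ?_, O', hO', fun z hz => ?_⟩
    · rintro (_ | j) hj
      · exact ⟨he, hsup.symm⟩
      · exact hb j (Nat.lt_of_succ_lt_succ hj)
    · rw [hinv z hz]
      exact hcl' _ (hcl _ ⟨z, hz, rfl⟩) (hsq z).1 (hsq z).2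

/-- A valid word can be shadowed by a regular one, up to any symmetry of the square. -/
theorem exists_isRegular_of_isValid {n : ℕ} (a : Fin n → digits) (ha : IsValid a) {f : ℂ ≃ᵢ ℂ}
    (hf : f ∈ dihedralEight) :
    ∃ b : Fin n → digits, IsRegular b ∧ f '' cylinder a ⊆ closure (cylinder b) ∧
      ∀ j : Fin n, supNorm (GaussianInt.toComplex (a j)) =
        supNorm (GaussianInt.toComplex (b j)) := by
  obtain ⟨ε, s, hε, hfs⟩ := exists_act_of_mem hf
  -- The default `0` is not a digit; only indices below `n` are ever read.
  let a' : ℕ → GaussianInt := fun j => if h : j < n then a ⟨j, h⟩ else 0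
  have ha' : ∀ (j : ℕ) (h : j < n), a' j = a ⟨j, h⟩ := fun j h => dif_pos h
  -- The initial state is `∅`, whose closed region is the whole closed square and so is preserved by
  -- every symmetry.
  obtain ⟨b, hb, O, hO, hcl⟩ := exists_openPiece n a'
    (fun j hj => by rw [ha' j hj]; exact (a ⟨j, hj⟩).2) ∅ (by simp) isFull_empty ε hε s
    (cylinder a) ha
    (fun z hz => by
      obtain ⟨h1, h2⟩ := abs_le_of_mem_fundamentalSquare hz.1
      obtain ⟨h3, h4⟩ := act_square hε s h1 h2
      exact ⟨h3, h4, by simp⟩)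
    (fun z hz j hj => by rw [ha' j hj]; exact hz.2 ⟨j, hj⟩)
  have hsub : O ⊆ cylinder (fun j : Fin n => (⟨b j, (hb j j.2).1⟩ : digits)) := fun z hz =>
    ⟨mem_fundamentalSquare (hO.subset hz).1 (hO.subset hz).2.1,
      fun j => hO.hasDigits z hz j j.2⟩
  refine ⟨fun j => ⟨b j, (hb j j.2).1⟩, hO.nonempty.mono (interior_maximal hsub hO.isOpen), ?_,
    fun j => ?_⟩
  · rintro _ ⟨z, hz, rfl⟩
    rw [hfs]
    exact closure_mono hsub (hcl z hz)
  · have := (hb j j.2).2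
    rwa [ha' j j.2] at this

end HurwitzCF

theorem mainTheorem8 (n : ℕ) (hn : 2 ≤ n) (a : Fin n → HurwitzCF.digits)
    (ha : HurwitzCF.IsIrregular a) (f : ℂ ≃ᵢ ℂ) (hf : f ∈ HurwitzCF.dihedralEight) :
    ∃ b : Fin n → HurwitzCF.digits, HurwitzCF.IsRegular b ∧
      f '' HurwitzCF.cylinder a ⊆ closure (HurwitzCF.cylinder b) ∧
      ∀ j : Fin n, HurwitzCF.supNorm (GaussianInt.toComplex (a j)) =
        HurwitzCF.supNorm (GaussianInt.toComplex (b j)) :=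
  HurwitzCF.exists_isRegular_of_isValid a ha.1 hf
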